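/- Let $K\ge 1$, $0<P_{\max}<\infty$, $0<\sigma_N^2<\infty$, $s_{\min}<s_{\max}$, and let $\mathcal X\subseteq\mathcal S:=[s_{\min},s_{\max}]$ be compact. For $k=1,\dots,K$ let $\varphi_k$ be a real function, bounded on $\mathcal S$ and continuous on $\mathcal X$, put $\varphi_{\min}=\min_k\inf_{s\in\mathcal S}\varphi_k(s)$ and $\varphi_{\max}=\max_k\sup_{s\in\mathcal S}\varphi_k(s)$, and let $g:[\varphi_{\min},\varphi_{\max}]\to[0,P_{\max}]$ be a continuous bijection. Let $\mathbf X=(X_1,\dots,X_K)$ be an $\mathcal X^K$-valued random vector (the sensor readings), let $\Theta_k[m]$ ($1\le k\le K$, $m\ge 1$) be i.i.d. random phases, uniform on $[0,2\pi)$, and let $N[m]$ ($m\ge1$) be i.i.d. proper complex Gaussian variables with mean $0$ and variance $\sigma_N^2$; the vector $\mathbf X$, the family of phases and the family of noise samples are independent. Put $P_k=g(\varphi_k(X_k))$ and $S_k[m]=e^{i\Theta_k[m]}$. For a sequence length $M$ write $\mathbf S_k=(S_k[1],\dots,S_k[M])^{\sf T}$ and $\mathbf N=(N[1],\dots,N[M])^{\sf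 T}$; the overall noise in the received energy is $$\Delta=\sum_{k=1}^K\sum_{\ell\ne k}\sqrt{P_kP_\ell}\,\mathbf S_k^{\sf H}\mathbf S_\ell+2\sum_{k=1}^K\sqrt{P_k}\,\mathrm{Re}\{\mathbf S_k^{\sf H}\mathbf N\}+\mathbf N^{\sf H}\mathbf N,$$ so that $\bigl\|\sum_{k}\sqrt{P_k}\,\mathbf S_k+\mathbf N\bigr\|_2^2=M\sum_kP_k+\Delta$. For $\mathbf x\in\mathcal X^K$ let $\Delta|\mathbf x$ be the random variable obtained from $\Delta$ by replacing $\mathbf X$ by $\mathbf x$, that is, $P_k$ by $p_k=g(\varphi_k(x_k))$. Then: (i) for every $M$, the laws of $\Delta|\mathbf x$ are a version of the conditional distribution of $\Delta$ given $\mathbf X=\mathbf x$ (they agree with it for almost every $\mathbf x$ with respect to the law of $\mathbf X$); (ii) for every $\mathbf x\in\mathcal X^K$ and every $M$, $\Delta|\mathbf x$ is square-integrable with $\mathbb E\{\Delta|\mathbf x\}=M\sigma_N^2$ and $$\sigma_{\Delta|\mathbf x}^2:=\mathbb E\{(\Delta|\mathbf x-M\sigma_N^2)^2\}=2M\sum_{1\le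 k<\ell\le K}p_kp_\ell+2M\sigma_N^2\sum_{k=1}^Kp_k+M\sigma_N^4;$$ (iii) for every $\mathbf x\in\mathcal X^K$, $$\frac{\Delta|\mathbf x-M\sigma_N^2}{\sigma_{\Delta|\mathbf x}}\ \stackrel{\mathrm d}{\longrightarrow}\ \mathcal N(0,1)\qquad\text{as } M\to\infty .$$ -/

import Mathlib

open MeasureTheory ProbabilityTheory Filter Topology
open scoped NNReal ENNReal

noncomputable section

namespace CoMAC

/-- Lower end `φ_min = min_k inf_{s ∈ S} φ_k(s)` of the range of the pre-processed readings. -/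
def phiMin {K : ℕ} (φ : Fin K → ℝ → ℝ) (S : Set ℝ) : ℝ := ⨅ k, sInf (φ k '' S)

/-- Upper end `φ_max = max_k sup_{s ∈ S} φ_k(s)` of the range of the pre-processed readings. -/
def phiMax {K : ℕ} (φ : Fin K → ℝ → ℝ) (S : Set ℝ) : ℝ := ⨆ k, sSup (φ k '' S)

/-- Transmit powers `p_k = g (φ_k (x_k))`. -/
def power {K : ℕ} (φ : Fin K → ℝ → ℝ) (g : ℝ → ℝ) (x : Fin K → ℝ) : Fin K → ℝ :=
  fun k => g (φ k (x k))

/-- Transmit symbol `e^{iθ}`. -/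
def symbol (θ : ℝ) : ℂ := Complex.exp (Complex.I * θ)

/-- Channel output `Y[m] = ∑_k √p_k S_k[m] + N[m]` for powers `p`, phases `θ` and noise `n`. -/
def received {K : ℕ} (p : Fin K → ℝ) (θ : Fin K → ℕ → ℝ) (n : ℕ → ℂ) (m : ℕ) : ℂ :=
  ∑ k, (Real.sqrt (p k) : ℂ) * symbol (θ k m) + n m

/-- `Δ₁ = ∑_k ∑_{l ≠ k} √(p_k p_l) S_kᴴ S_l`, a real number (see `noise1_ofReal`); the sequence
positions `1, …, M` are numbered `0, …, M - 1`. -/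
def noise1 {K : ℕ} (p : Fin K → ℝ) (M : ℕ) (θ : Fin K → ℕ → ℝ) : ℝ :=
  (∑ k, ∑ l ∈ Finset.univ.erase k, (Real.sqrt (p k * p l) : ℂ) *
    ∑ m ∈ Finset.range M, star (symbol (θ k m)) * symbol (θ l m)).re

/-- `Δ₂ = 2 ∑_k √p_k Re (S_kᴴ N)`. -/
def noise2 {K : ℕ} (p : Fin K → ℝ) (M : ℕ) (θ : Fin K → ℕ → ℝ) (n : ℕ → ℂ) : ℝ :=
  2 * ∑ k, Real.sqrt (p k) * (∑ m ∈ Finset.range M, star (symbol (θ k m)) * n m).re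

/-- `Δ₃ = Nᴴ N`. -/
def noise3 (M : ℕ) (n : ℕ → ℂ) : ℝ := ∑ m ∈ Finset.range M, ‖n m‖ ^ 2

/-- The overall noise `Δ = Δ₁ + Δ₂ + Δ₃` for sequences of length `M`. -/
def overallNoise {K : ℕ} (p : Fin K → ℝ) (M : ℕ) (θ : Fin K → ℕ → ℝ) (n : ℕ → ℂ) : ℝ :=
  noise1 p M θ + noise2 p M θ n + noise3 M n

/-- The overall noise `Δ|x` when the sensor readings take the value `x`, as a random variable:
only the phases `Θ` and the receiver noise `N` remain random. -/
def noiseGiven {Ω : Type*} {K : ℕ} (φ : Fin K → ℝ → ℝ) (g : ℝ → ℝ)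
    (Θ : Fin K → ℕ → Ω → ℝ) (N : ℕ → Ω → ℂ) (M : ℕ) (x : Fin K → ℝ) (ω : Ω) : ℝ :=
  overallNoise (power φ g x) M (fun k m => Θ k m ω) (fun m => N m ω)

/-- `σ²_{Δ|x} = E[(Δ - M σ_N²)² | X = x]`. -/
def noiseVarGiven {Ω : Type*} [MeasurableSpace Ω] (P : Measure Ω) {K : ℕ}
    (φ : Fin K → ℝ → ℝ) (g : ℝ → ℝ) (Θ : Fin K → ℕ → Ω → ℝ) (N : ℕ → Ω → ℂ) (noiseVar : ℝ≥0)
    (M : ℕ) (x : Fin K → ℝ) : ℝ :=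
  ∫ ω, (noiseGiven φ g Θ N M x ω - M * noiseVar) ^ 2 ∂P

/-- The proper (circularly symmetric) complex normal distribution with mean `0` and variance `v`:
real and imaginary part are independent, each normal with mean `0` and variance `v / 2`. -/
def complexGaussian (v : ℝ≥0) : Measure ℂ :=
  ((gaussianReal 0 (v / 2)).prod (gaussianReal 0 (v / 2))).map (fun z : ℝ × ℝ => ⟨z.1, z.2⟩)

/-- The double sum defining `Δ₁` is real. -/
theorem noise1_ofReal {K : ℕ} (p : Fin K → ℝ) (M : ℕ) (θ : Fin K → ℕ → ℝ) :
    (noise1 p M θ : ℂ) = ∑ k, ∑ l ∈ Finset.univ.erase k, (Real.sqrt (p k * p l) : ℂ) *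
      ∑ m ∈ Finset.range M, star (symbol (θ k m)) * symbol (θ l m) := by
  unfold noise1
  refine Complex.conj_eq_iff_re.mp ?_
  simp only [map_sum, map_mul, Complex.conj_ofReal, Complex.star_def, Complex.conj_conj]
  rw [Finset.sum_comm' (t' := Finset.univ) (s' := fun l => Finset.univ.erase l)]
  · refine Finset.sum_congr rfl fun k _ => Finset.sum_congr rfl fun l _ => ?_
    rw [mul_comm (p l)]
    congr 1
    exact Finset.sum_congr rfl fun m _ => mul_comm _ _
  · intro a b
    simp [eq_comm]

/-- The received energy is `‖Y‖² = M ∑_k p_k + Δ`. -/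
theorem energy_eq {K : ℕ} (p : Fin K → ℝ) (hp : ∀ k, 0 ≤ p k) (M : ℕ) (θ : Fin K → ℕ → ℝ)
    (n : ℕ → ℂ) :
    ∑ m ∈ Finset.range M, ‖received p θ n m‖ ^ 2 = M * ∑ k, p k + overallNoise p M θ n := by
  have hs : ∀ t : ℝ, star (symbol t) * symbol t = 1 := by
    intro t
    rw [symbol, Complex.star_def, ← Complex.exp_conj, ← Complex.exp_add]
    simp
  have key : ∀ m, ‖received p θ n m‖ ^ 2 = ∑ k, p k
      + (∑ k, ∑ l ∈ Finset.univ.erase k, (Real.sqrt (p k * p l) : ℂ) *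
        (star (symbol (θ k m)) * symbol (θ l m))).re
      + 2 * ∑ k, Real.sqrt (p k) * (star (symbol (θ k m)) * n m).re + ‖n m‖ ^ 2 := by
    intro m
    set A : ℂ := ∑ k, (Real.sqrt (p k) : ℂ) * symbol (θ k m) with hA
    have h1 : ‖received p θ n m‖ ^ 2 = (star A * A).re + 2 * (star A * n m).re + ‖n m‖ ^ 2 := by
      rw [received, ← hA, ← Complex.normSq_eq_norm_sq, ← Complex.normSq_eq_norm_sq]
      simp [Complex.normSq_apply]
      ring
    have h2 : star A * A = ((∑ k, p k : ℝ) : ℂ)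
        + ∑ k, ∑ l ∈ Finset.univ.erase k, (Real.sqrt (p k * p l) : ℂ) *
          (star (symbol (θ k m)) * symbol (θ l m)) := by
      rw [hA, star_sum, Finset.sum_mul_sum, Complex.ofReal_sum, ← Finset.sum_add_distrib]
      refine Finset.sum_congr rfl fun k _ => ?_
      rw [← Finset.add_sum_erase _ _ (Finset.mem_univ k)]
      congr 1
      · rw [star_mul', Complex.star_def, Complex.conj_ofReal]
        have := hs (θ k m)
        rw [Complex.star_def] at this
        calc _ = ((Real.sqrt (p k) : ℂ) * (Real.sqrt (p k) : ℂ)) *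
            ((starRingEnd ℂ) (symbol (θ k m)) * symbol (θ k m)) := by ring
          _ = _ := by rw [this, ← Complex.ofReal_mul, Real.mul_self_sqrt (hp k), mul_one]
      · refine Finset.sum_congr rfl fun l _ => ?_
        rw [star_mul', Complex.star_def, Complex.conj_ofReal, Real.sqrt_mul (hp k)]
        push_cast
        ring
    have h3 : (star A * n m).re = ∑ k, Real.sqrt (p k) * (star (symbol (θ k m)) * n m).re := by
      rw [hA, star_sum, Finset.sum_mul, Complex.re_sum]
      refine Finset.sum_congr rfl fun k _ => ?_
      rw [star_mul', Complex.star_def, Complex.conj_ofReal, mul_assoc, Complex.re_ofReal_mul]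
    rw [h1, h2, h3, Complex.add_re, Complex.ofReal_re]
  simp only [key, Finset.sum_add_distrib, overallNoise, noise1, noise2, noise3]
  rw [Finset.sum_const, Finset.card_range, nsmul_eq_mul, ← Complex.re_sum, Finset.sum_comm,
    ← Finset.mul_sum, Finset.sum_comm (s := Finset.range M) (t := Finset.univ)]
  have e1 : ∀ k : Fin K, (∑ m ∈ Finset.range M, ∑ l ∈ Finset.univ.erase k,
      (Real.sqrt (p k * p l) : ℂ) * (star (symbol (θ k m)) * symbol (θ l m))) =
      ∑ l ∈ Finset.univ.erase k, (Real.sqrt (p k * p l) : ℂ) *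
        ∑ m ∈ Finset.range M, star (symbol (θ k m)) * symbol (θ l m) := by
    intro k
    rw [Finset.sum_comm]
    simp only [Finset.mul_sum]
  simp only [e1, ← Finset.mul_sum, Complex.re_sum]
  ring

end CoMAC

end

/-! For fixed `x`, the energy identity `energy_eq` turns the overall noise into a centred energy:
`Δ|x = ∑_m |Y[m]|² - M ∑_k p_k`. The outputs `Y[m]` use disjoint blocks of independent phases and
noise samples, with the same laws in each block, so the `|Y[m]|²` are i.i.d., and (ii) and (iii)
reduce to the mean and variance of one `|Y[m]|²` and the classical central limit theorem.

These two numbers come from viewing `Y[m]` as a sum of `K + 1` independent variables whose low-order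
mixed moments vanish as for circularly symmetric laws. This property is stable under independent
sums (`HasCircularMoments.add`), and the variance of the squared modulus gains `2 v v'` for each
pair of summands with mean energies `v` and `v'`. A symbol of constant modulus contributes no
variance of its own, while the Gaussian sample contributes `σ_N⁴`.

Claim (i) is the substitution rule for independent variables, `condDistrib_comp_of_indepFun`. -/

open scoped ComplexConjugate

namespace CoMAC

/-! ### Mixed moments and circular moment conditions. -/

section MixedMoment

variable {Ω : Type*} [MeasurableSpace Ω] {P : Measure Ω}

/-- The mixed moment `E[c ^ i * conj c ^ j]` of a complex random variable. -/
noncomputable def mixedMoment (P : Measure Ω) (c : Ω → ℂ) (i j : ℕ) : ℂ :=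
  ∫ ω, c ω ^ i * conj (c ω) ^ j ∂P

theorem mixedMoment_swap (c : Ω → ℂ) (i j : ℕ) :
    mixedMoment P c j i = conj (mixedMoment P c i j) := by
  rw [mixedMoment, mixedMoment, ← integral_conj]
  congr with ω
  simp [mul_comm]

theorem mixedMoment_zero_zero [IsProbabilityMeasure P] (c : Ω → ℂ) : mixedMoment P c 0 0 = 1 := by
  simp [mixedMoment]

theorem mixedMoment_map {Ω' : Type*} [MeasurableSpace Ω'] {c : Ω → Ω'} (hc : AEMeasurable c P)
    {f : Ω' → ℂ} (hf : Measurable f) (i j : ℕ) :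
    mixedMoment (P.map c) f i j = mixedMoment P (fun ω => f (c ω)) i j := by
  rw [mixedMoment, mixedMoment, integral_map hc (by fun_prop)]

theorem mixedMoment_const_mul (a : ℂ) (c : Ω → ℂ) (i j : ℕ) :
    mixedMoment P (fun ω => a * c ω) i j = a ^ i * conj a ^ j * mixedMoment P c i j := by
  rw [mixedMoment, mixedMoment, ← integral_const_mul]
  congr with ω
  simp only [map_mul]
  ring

theorem integrable_pow_mul_conj_pow [IsFiniteMeasure P] {c : Ω → ℂ} {n : ℕ} (hc : MemLp c n P)
    {i j : ℕ} (hij : i + j ≤ n) : Integrable (fun ω => c ω ^ i * conj (c ω) ^ j) P := by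
  have hm := hc.aestronglyMeasurable
  have h : MemLp c (i + j : ℕ) P := hc.mono_exponent (by exact_mod_cast hij)
  refine (h.integrable_norm_pow').mono' ?_ (ae_of_all _ fun ω => ?_)
  · exact (hm.pow i).mul ((Complex.continuous_conj.comp_aestronglyMeasurable hm).pow j)
  · simp [pow_add]

/-- Both powers are expanded binomially and independence factors each term; `i + j ≤ n` bounds the
degree in `b` and in `c` of every term, hence gives integrability. -/
theorem mixedMoment_add [IsFiniteMeasure P] {b c : Ω → ℂ} {n : ℕ} (hb : MemLp b n P)
    (hc : MemLp c n P) (hbc : IndepFun b c P) {i j : ℕ} (hij : i + j ≤ n) :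
    mixedMoment P (fun ω => b ω + c ω) i j =
      ∑ k ∈ Finset.range (i + 1), ∑ l ∈ Finset.range (j + 1), (i.choose k * j.choose l : ℂ) *
        (mixedMoment P b k l * mixedMoment P c (i - k) (j - l)) := by
  have hmul : ∀ k ∈ Finset.range (i + 1), ∀ l ∈ Finset.range (j + 1),
      Integrable (fun ω => (b ω ^ k * conj (b ω) ^ l) *
          (c ω ^ (i - k) * conj (c ω) ^ (j - l))) P ∧
        ∫ ω, (b ω ^ k * conj (b ω) ^ l) * (c ω ^ (i - k) * conj (c ω) ^ (j - l)) ∂P =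
          mixedMoment P b k l * mixedMoment P c (i - k) (j - l) := by
    intro k hk l hl
    rw [Finset.mem_range] at hk hl
    have hi := integrable_pow_mul_conj_pow hb (i := k) (j := l) (by omega)
    have hj := integrable_pow_mul_conj_pow hc (i := i - k) (j := j - l) (by omega)
    have hind : IndepFun (fun ω => b ω ^ k * conj (b ω) ^ l)
        (fun ω => c ω ^ (i - k) * conj (c ω) ^ (j - l)) P :=
      hbc.comp (φ := fun z : ℂ => z ^ k * conj z ^ l)
        (ψ := fun z : ℂ => z ^ (i - k) * conj z ^ (j - l)) (by fun_prop) (by fun_prop)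
    exact ⟨hind.integrable_mul hi hj,
      hind.integral_mul_eq_mul_integral hi.aestronglyMeasurable hj.aestronglyMeasurable⟩
  have hexp : ∀ ω, (b ω + c ω) ^ i * conj (b ω + c ω) ^ j =
      ∑ k ∈ Finset.range (i + 1), ∑ l ∈ Finset.range (j + 1), (i.choose k * j.choose l : ℂ) *
        ((b ω ^ k * conj (b ω) ^ l) * (c ω ^ (i - k) * conj (c ω) ^ (j - l))) := by
    intro ω
    rw [map_add, add_pow, add_pow, Finset.sum_mul_sum]
    refine Finset.sum_congr rfl fun k _ => Finset.sum_congr rfl fun l _ => ?_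
    ring
  rw [mixedMoment]
  simp only [hexp]
  rw [integral_finsetSum _ fun k hk => integrable_finsetSum _ fun l hl =>
    ((hmul k hk l hl).1).const_mul _]
  refine Finset.sum_congr rfl fun k hk => ?_
  rw [integral_finsetSum _ fun l hl => ((hmul k hk l hl).1).const_mul _]
  refine Finset.sum_congr rfl fun l hl => ?_
  rw [integral_const_mul, (hmul k hk l hl).2]

/-- The complex random variable `c` has a finite fourth moment, its mixed moments `E[c]`, `E[c²]`,
`E[|c|² c]` vanish as for a circularly symmetric law, `|c|²` has mean `v` and variance `w`. -/
structure HasCircularMoments (P : Measure Ω) (c : Ω → ℂ) (v w : ℝ) : Prop where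
  memLp : MemLp c (4 : ℕ) P
  one_zero : mixedMoment P c 1 0 = 0
  two_zero : mixedMoment P c 2 0 = 0
  two_one : mixedMoment P c 2 1 = 0
  one_one : mixedMoment P c 1 1 = v
  two_two : mixedMoment P c 2 2 = w + v ^ 2

namespace HasCircularMoments

variable {b c : Ω → ℂ} {v w v' w' : ℝ}

theorem zero_one (hc : HasCircularMoments P c v w) : mixedMoment P c 0 1 = 0 := by
  rw [mixedMoment_swap, hc.one_zero, map_zero]

theorem zero_two (hc : HasCircularMoments P c v w) : mixedMoment P c 0 2 = 0 := by
  rw [mixedMoment_swap, hc.two_zero, map_zero]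

theorem one_two (hc : HasCircularMoments P c v w) : mixedMoment P c 1 2 = 0 := by
  rw [mixedMoment_swap, hc.two_one, map_zero]

protected theorem zero [IsProbabilityMeasure P] : HasCircularMoments P (fun _ => 0) 0 0 where
  memLp := MemLp.zero'
  one_zero := by simp [mixedMoment]
  two_zero := by simp [mixedMoment]
  two_one := by simp [mixedMoment]
  one_one := by simp [mixedMoment]
  two_two := by simp [mixedMoment]

/-- Every unbalanced term of the expansion contains a vanishing moment. In degree `(2, 2)` only
`E|b|⁴ + 4 E|b|² E|c|² + E|c|⁴` survives, and subtracting `(v + v')²` leaves the cross term `2 v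
v'`. -/
theorem add [IsProbabilityMeasure P] (hb : HasCircularMoments P b v w)
    (hc : HasCircularMoments P c v' w') (hbc : IndepFun b c P) :
    HasCircularMoments P (fun ω => b ω + c ω) (v + v') (w + w' + 2 * v * v') := by
  refine ⟨hb.memLp.add hc.memLp, ?_, ?_, ?_, ?_, ?_⟩
  all_goals
    rw [mixedMoment_add hb.memLp hc.memLp hbc (by norm_num)]
    simp [Finset.sum_range_succ, mixedMoment_zero_zero, hb.one_zero, hb.two_zero, hb.two_one,
      hb.one_one, hb.two_two, hb.zero_one, hb.zero_two, hb.one_two, hc.one_zero, hc.two_zero,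
      hc.two_one, hc.one_one, hc.two_two, hc.zero_one, hc.zero_two, hc.one_two]
  · ring
  · ring

/-- The difference of squares is the sum of `v i * v j` over ordered pairs `i ≠ j`, which collects
the cross terms of `add`. -/
theorem sum [IsProbabilityMeasure P] {ι : Type*} [DecidableEq ι] {c : ι → Ω → ℂ} {v w : ι → ℝ}
    (hc : ∀ i, HasCircularMoments P (c i) (v i) (w i)) (hm : ∀ i, Measurable (c i))
    (hind : iIndepFun c P) (s : Finset ι) :
    HasCircularMoments P (fun ω => ∑ i ∈ s, c i ω) (∑ i ∈ s, v i)
      (∑ i ∈ s, w i + ((∑ i ∈ s, v i) ^ 2 - ∑ i ∈ s, v i ^ 2)) := by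
  induction s using Finset.induction_on with
  | empty => simpa using HasCircularMoments.zero
  | insert a s ha ih =>
    have hI : IndepFun (fun ω => ∑ i ∈ s, c i ω) (c a) P := by
      simpa only [Finset.sum_fn] using hind.indepFun_finsetSum_of_notMem hm ha
    convert! ih.add (hc a) hI using 1
    · ext ω
      rw [Finset.sum_insert ha, add_comm]
    · rw [Finset.sum_insert ha, add_comm]
    · simp only [Finset.sum_insert ha]
      ring

theorem memLp_norm_sq (hc : HasCircularMoments P c v w) : MemLp (fun ω => ‖c ω‖ ^ 2) 2 P := by
  have h := hc.memLp.norm_rpow_div 2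
  have e : ((4 : ℕ) : ℝ≥0∞) / 2 = 2 := by
    rw [eq_comm, ENNReal.eq_div_iff] <;> norm_num
  rw [e] at h
  simpa using h

theorem integral_norm_sq (hc : HasCircularMoments P c v w) : ∫ ω, ‖c ω‖ ^ 2 ∂P = v := by
  have h := hc.one_one
  have e : ∀ ω, c ω ^ 1 * conj (c ω) ^ 1 = ((‖c ω‖ ^ 2 : ℝ) : ℂ) := fun ω => by
    rw [pow_one, pow_one, Complex.mul_conj']
    norm_cast
  simp only [mixedMoment, e] at h
  rw [integral_complex_ofReal] at h
  exact_mod_cast h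

theorem variance_norm_sq [IsProbabilityMeasure P] (hc : HasCircularMoments P c v w) :
    Var[fun ω => ‖c ω‖ ^ 2; P] = w := by
  have h := hc.two_two
  have e : ∀ ω, c ω ^ 2 * conj (c ω) ^ 2 = (((‖c ω‖ ^ 2) ^ 2 : ℝ) : ℂ) := fun ω => by
    rw [← mul_pow, Complex.mul_conj']
    norm_cast
  simp only [mixedMoment, e] at h
  rw [integral_complex_ofReal] at h
  rw [variance_eq_sub hc.memLp_norm_sq, hc.integral_norm_sq]
  have h' : ∫ ω, (‖c ω‖ ^ 2) ^ 2 ∂P = w + v ^ 2 := by exact_mod_cast h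
  simp only [Pi.pow_apply, h']
  ring

end HasCircularMoments

end MixedMoment

/-! ### Moments of the Gaussian noise and of the random-phase symbols. -/

section Laws

variable {Ω : Type*} [MeasurableSpace Ω] {P : Measure Ω}

/-- The moments are derivatives at `0` of the moment generating function `f`. Since `f' = v t f`,
every derivative is a polynomial times `f`. -/
theorem integral_pow_gaussianReal (v : ℝ≥0) :
    ∫ x, x ∂gaussianReal 0 v = 0 ∧ ∫ x, x ^ 2 ∂gaussianReal 0 v = v ∧
      ∫ x, x ^ 3 ∂gaussianReal 0 v = 0 ∧ ∫ x, x ^ 4 ∂gaussianReal 0 v = 3 * (v : ℝ) ^ 2 := by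
  set f : ℝ → ℝ := mgf id (gaussianReal 0 v) with hf
  have hmom : ∀ n : ℕ, ∫ x, x ^ n ∂gaussianReal 0 v = iteratedDeriv n f 0 := by
    intro n
    rw [hf, iteratedDeriv_mgf_zero] <;> simp
  have hfv : f = fun t => Real.exp (v * t ^ 2 / 2) := by
    rw [hf, mgf_id_gaussianReal]
    simp
  have hf' : ∀ t, HasDerivAt f (v * t * f t) t := by
    intro t
    have h : HasDerivAt (fun t : ℝ => (v : ℝ) * t ^ 2 / 2) (v * t) t := by
      convert! (((hasDerivAt_id t).pow 2).const_mul (v : ℝ)).div_const 2 using 1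
      simp
      ring
    rw [hfv]
    convert! h.exp using 1
    ring
  -- Differentiating `q f` replaces the polynomial factor `q` by `q' + v t q`.
  have step : ∀ (q : ℝ → ℝ) (q' : ℝ → ℝ), (∀ t, HasDerivAt q (q' t) t) →
      deriv (fun t => q t * f t) = fun t => (q' t + v * t * q t) * f t := by
    intro q q' hq
    funext t
    rw [((hq t).fun_mul (hf' t)).deriv]
    ring
  have d1 : iteratedDeriv 1 f = fun t => (v * t) * f t := by
    rw [iteratedDeriv_one]
    funext t
    exact (hf' t).deriv
  have d2 : iteratedDeriv 2 f = fun t => (v + v ^ 2 * t ^ 2) * f t := by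
    rw [iteratedDeriv_succ, d1, step _ (fun _ => (v : ℝ))
      fun t => by simpa using (hasDerivAt_id t).const_mul (v : ℝ)]
    funext t
    ring
  have d3 : iteratedDeriv 3 f = fun t => (3 * v ^ 2 * t + v ^ 3 * t ^ 3) * f t := by
    rw [iteratedDeriv_succ, d2, step _ (fun t => 2 * (v : ℝ) ^ 2 * t) fun t => by
      convert! (((hasDerivAt_id t).pow 2).const_mul ((v : ℝ) ^ 2)).const_add (v : ℝ) using 1
      simp
      ring]
    funext t
    ring
  have d4 : iteratedDeriv 4 f =
      fun t => (3 * v ^ 2 + 6 * v ^ 3 * t ^ 2 + v ^ 4 * t ^ 4) * f t := by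
    rw [iteratedDeriv_succ, d3,
      step _ (fun t => 3 * (v : ℝ) ^ 2 + 3 * (v : ℝ) ^ 3 * t ^ 2) fun t => by
        convert! ((hasDerivAt_id t).const_mul (3 * (v : ℝ) ^ 2)).add
          (((hasDerivAt_id t).pow 3).const_mul ((v : ℝ) ^ 3)) using 1
        simp
        ring]
    funext t
    ring
  have f0 : f 0 = 1 := by simp [hfv]
  have h1 := hmom 1
  simp only [pow_one] at h1
  rw [h1, hmom 2, hmom 3, hmom 4, d1, d2, d3, d4]
  simp [f0]

theorem mixedMoment_ofReal (u : Ω → ℝ) (i j : ℕ) :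
    mixedMoment P (fun ω => (u ω : ℂ)) i j = (∫ ω, u ω ^ (i + j) ∂P : ℝ) := by
  rw [mixedMoment, ← integral_complex_ofReal]
  congr with ω
  rw [Complex.conj_ofReal, ← pow_add, Complex.ofReal_pow]

/-- With independent parts of variance `v / 2`, odd moments vanish and the two second moments cancel
in `E[c²]`. The fourth absolute moment is `2 · 3 (v/2)² + 2 (v/2)² = 2 v²`, so `w = v²`. -/
theorem hasCircularMoments_complexGaussian (v : ℝ≥0) :
    HasCircularMoments (complexGaussian v) id v ((v : ℝ) ^ 2) := by
  set γ := gaussianReal 0 (v / 2) with hγ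
  have hmeas : Measurable fun z : ℝ × ℝ => (⟨z.1, z.2⟩ : ℂ) :=
    Complex.measurableEquivRealProd.symm.measurable
  have hfun : (fun z : ℝ × ℝ => (⟨z.1, z.2⟩ : ℂ)) =
      fun z => (z.1 : ℂ) + Complex.I * (z.2 : ℂ) := by
    funext z
    rw [Complex.mk_eq_add_mul_I, mul_comm]
  have hL : MemLp (id : ℝ → ℝ) (4 : ℕ) γ := memLp_id_gaussianReal' _ (by simp)
  have h1 : MemLp (fun z : ℝ × ℝ => (z.1 : ℂ)) (4 : ℕ) (γ.prod γ) :=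
    (hL.comp_fst γ).ofReal
  have h2 : MemLp (fun z : ℝ × ℝ => Complex.I * (z.2 : ℂ)) (4 : ℕ) (γ.prod γ) :=
    (hL.comp_snd γ).ofReal.const_mul _
  have hind : IndepFun (fun z : ℝ × ℝ => (z.1 : ℂ)) (fun z => Complex.I * (z.2 : ℂ))
      (γ.prod γ) :=
    indepFun_prod (X := fun x : ℝ => (x : ℂ)) (Y := fun x : ℝ => Complex.I * (x : ℂ))
      (by fun_prop) (by fun_prop)
  obtain ⟨g1, g2, g3, g4⟩ := integral_pow_gaussianReal (v / 2)
  rw [← hγ] at g1 g2 g3 g4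
  have m1 : ∀ i j, mixedMoment (γ.prod γ) (fun z : ℝ × ℝ => (z.1 : ℂ)) i j =
      (∫ x, x ^ (i + j) ∂γ : ℝ) := by
    intro i j
    rw [mixedMoment_ofReal, integral_fun_fst (fun x : ℝ => x ^ (i + j))]
    simp
  have m2 : ∀ i j, mixedMoment (γ.prod γ) (fun z : ℝ × ℝ => Complex.I * (z.2 : ℂ)) i j =
      Complex.I ^ i * (-Complex.I) ^ j * (∫ x, x ^ (i + j) ∂γ : ℝ) := by
    intro i j
    rw [mixedMoment_const_mul, mixedMoment_ofReal, integral_fun_snd (fun x : ℝ => x ^ (i + j)),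
      Complex.conj_I]
    simp
  have hmom : ∀ i j, mixedMoment (complexGaussian v) id i j =
      mixedMoment (γ.prod γ) (fun z : ℝ × ℝ => (z.1 : ℂ) + Complex.I * (z.2 : ℂ)) i j := by
    intro i j
    rw [complexGaussian, mixedMoment_map hmeas.aemeasurable measurable_id, ← hfun]
    rfl
  refine ⟨?_, ?_, ?_, ?_, ?_, ?_⟩
  · rw [complexGaussian, memLp_map_measure_iff aestronglyMeasurable_id hmeas.aemeasurable]
    change MemLp (fun z : ℝ × ℝ => (⟨z.1, z.2⟩ : ℂ)) _ _
    rw [hfun]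
    exact h1.add h2
  all_goals
    rw [hmom, mixedMoment_add h1 h2 hind (by norm_num)]
    simp [Finset.sum_range_succ, m1, m2, g1, g2, g3, g4]
  ring_nf

/-- A nontrivial character integrates to zero over a full period. -/
theorem integral_exp_uniform {U : Ω → ℝ} (hU : AEMeasurable U P)
    (hu : pdf.IsUniform U (Set.Ico 0 (2 * Real.pi)) P) {n : ℤ} (hn : n ≠ 0) :
    ∫ ω, Complex.exp (n * Complex.I * U ω) ∂P = 0 := by
  have h := integral_map (μ := P) (φ := U) hU
    (f := fun x : ℝ => Complex.exp (n * Complex.I * x)) (by fun_prop)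
  rw [← h, show P.map U = _ from hu, ProbabilityTheory.cond, integral_smul_measure,
    integral_Ico_eq_integral_Ioc, ← intervalIntegral.integral_of_le (by positivity),
    integral_exp_mul_complex (by simp [hn])]
  have e : Complex.exp (n * Complex.I * (2 * Real.pi : ℝ)) = 1 := by
    rw [← Complex.exp_int_mul_two_pi_mul_I n]
    congr 1
    push_cast
    ring
  rw [e]
  simp

theorem symbol_pow_mul_conj_pow (θ : ℝ) (i j : ℕ) :
    symbol θ ^ i * conj (symbol θ) ^ j = Complex.exp (((i : ℤ) - (j : ℤ) : ℤ) * Complex.I * θ) := by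
  rw [symbol, ← Complex.exp_conj, ← Complex.exp_nat_mul, ← Complex.exp_nat_mul, ← Complex.exp_add]
  congr 1
  simp
  ring

theorem measurable_symbol : Measurable symbol := by
  unfold symbol
  fun_prop

/-- Unbalanced moments are integrals of nontrivial characters; the modulus is constantly `√p`, hence
the variance parameter `0`. -/
theorem hasCircularMoments_symbol [IsProbabilityMeasure P] {U : Ω → ℝ} (hU : Measurable U)
    (hu : pdf.IsUniform U (Set.Ico 0 (2 * Real.pi)) P) {p : ℝ} (hp : 0 ≤ p) :
    HasCircularMoments P (fun ω => (Real.sqrt p : ℂ) * symbol (U ω)) p 0 := by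
  have hmom : ∀ i j, mixedMoment P (fun ω => symbol (U ω)) i j =
      ∫ ω, Complex.exp (((i : ℤ) - (j : ℤ) : ℤ) * Complex.I * U ω) ∂P := by
    intro i j
    simp only [mixedMoment, symbol_pow_mul_conj_pow]
  have hsq : (Real.sqrt p : ℂ) ^ 2 = p := by
    rw [← Complex.ofReal_pow, Real.sq_sqrt hp]
  have hzero : ∀ i j : ℕ, i ≠ j →
      mixedMoment P (fun ω => (Real.sqrt p : ℂ) * symbol (U ω)) i j = 0 := by
    intro i j hij
    rw [mixedMoment_const_mul, hmom, integral_exp_uniform hU.aemeasurable hu (by omega), mul_zero]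
  refine ⟨?_, hzero 1 0 (by norm_num), hzero 2 0 (by norm_num), hzero 2 1 (by norm_num), ?_, ?_⟩
  · refine MemLp.of_bound ((measurable_symbol.comp hU).const_mul _).aestronglyMeasurable
      (Real.sqrt p) (ae_of_all _ fun ω => ?_)
    have : ‖symbol (U ω)‖ = 1 := by
      rw [symbol, mul_comm, Complex.norm_exp_ofReal_mul_I]
    simp [this, abs_of_nonneg (Real.sqrt_nonneg p)]
  · rw [mixedMoment_const_mul, hmom, Complex.conj_ofReal, pow_one, ← sq, hsq]
    simp
  · rw [mixedMoment_const_mul, hmom, Complex.conj_ofReal, hsq]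
    simp
    ring

end Laws

/-! ### Merging and regrouping independent families. -/

section Independence

variable {Ω E : Type*} [MeasurableSpace Ω] [MeasurableSpace E] {P : Measure Ω}

/-- Two independent families, each consisting of independent variables, form together a family of
independent variables. -/
theorem iIndepFun_sumElim {ι κ : Type*} {f : ι → Ω → E} {g : κ → Ω → E}
    (hf : iIndepFun f P) (hg : iIndepFun g P)
    (hfg : IndepFun (fun ω i => f i ω) (fun ω j => g j ω) P) :
    iIndepFun (fun q : ι ⊕ κ => Sum.elim f g q) P := by
  classical
  rw [iIndepFun_iff_measure_inter_preimage_eq_mul] at hf hg ⊢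
  intro S s hs
  have hset : ⋂ q ∈ S, Sum.elim f g q ⁻¹' s q =
      ((fun ω i => f i ω) ⁻¹' (⋂ i ∈ S.toLeft, (fun x : ι → E => x i) ⁻¹' s (Sum.inl i))) ∩
      ((fun ω j => g j ω) ⁻¹' (⋂ j ∈ S.toRight, (fun x : κ → E => x j) ⁻¹' s (Sum.inr j))) := by
    ext ω
    simp [Sum.forall]
  rw [hset, hfg.measure_inter_preimage_eq_mul]
  · have e1 := hf S.toLeft (sets := fun i => s (Sum.inl i)) (by simpa using fun i hi => hs _ hi)
    have e2 := hg S.toRight (sets := fun i => s (Sum.inr i)) (by simpa using fun i hi => hs _ hi)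
    simp only [Set.preimage_iInter, Set.preimage_preimage]
    rw [← S.toLeft_disjSum_toRight, Finset.prod_disjSum]
    simp only [Finset.toLeft_disjSum, Finset.toRight_disjSum]
    exact congrArg₂ _ e1 e2
  · exact Finset.measurableSet_biInter _ fun i hi =>
      measurable_pi_apply i (hs _ (by simpa using hi))
  · exact Finset.measurableSet_biInter _ fun i hi =>
      measurable_pi_apply i (hs _ (by simpa using hi))

/-- The rows of an array of independent variables are independent. -/
theorem iIndepFun_rows [IsProbabilityMeasure P] {ι κ : Type*} {f : ι × κ → Ω → E}
    (hm : ∀ q, Measurable (f q)) (hf : iIndepFun f P) :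
    iIndepFun (fun i ω j => f (i, j) ω) P := by
  have : ∀ q, IsProbabilityMeasure (P.map (f q)) := fun q =>
    Measure.isProbabilityMeasure_map (hm q).aemeasurable
  have hrow : ∀ i, P.map (fun ω j => f (i, j) ω) =
      Measure.infinitePi fun j => P.map (f (i, j)) := fun i =>
    (hf.precomp (g := fun j => (i, j)) fun a b h => (Prod.mk.inj h).2).map_fun_eq_infinitePi_map
      fun j => hm (i, j)
  have hmeas : Measurable fun ω q => f q ω := measurable_pi_lambda _ hm
  rw [iIndepFun_iff_map_fun_eq_infinitePi_map
    fun i => measurable_pi_lambda _ fun j => hm (i, j)]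
  simp only [hrow]
  -- Currying carries the product law of the whole array to the product of the row laws.
  rw [← Measure.infinitePi_map_curry fun i j => P.map (f (i, j)),
    ← hf.map_fun_eq_infinitePi_map hm, Measure.map_map (MeasurableEquiv.measurable _) hmeas]
  rfl

end Independence

/-! ### Moments and central limit theorem for i.i.d. sums. -/

section IdenticallyDistributed

variable {Ω : Type*} [MeasurableSpace Ω] {P : Measure Ω} [IsProbabilityMeasure P]
  {E : ℕ → Ω → ℝ} {e W : ℝ}

theorem memLp_sum_sub (hE : ∀ m, MemLp (E m) 2 P) (M : ℕ) (a : ℝ) :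
    MemLp (fun ω => ∑ m ∈ Finset.range M, E m ω - a) 2 P :=
  (memLp_finsetSum _ fun m _ => hE m).sub (memLp_const a)

theorem integral_sum_range (hE : ∀ m, MemLp (E m) 2 P) (he : ∀ m, ∫ ω, E m ω ∂P = e) (M : ℕ) :
    ∫ ω, ∑ m ∈ Finset.range M, E m ω ∂P = M * e := by
  rw [integral_finsetSum _ fun m _ => (hE m).integrable one_le_two]
  simp [he]

theorem integral_sum_range_sub_sq (hE : ∀ m, MemLp (E m) 2 P) (he : ∀ m, ∫ ω, E m ω ∂P = e)
    (hW : ∀ m, Var[E m; P] = W) (hind : iIndepFun E P) (M : ℕ) :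
    ∫ ω, (∑ m ∈ Finset.range M, E m ω - M * e) ^ 2 ∂P = M * W := by
  have h := IndepFun.variance_sum (s := Finset.range M) (fun m _ => hE m)
    fun i _ j _ hij => hind.indepFun hij
  rw [variance_eq_integral (memLp_finsetSum' _ fun m _ => hE m).aemeasurable] at h
  simp only [Finset.sum_apply, integral_sum_range hE he, hW] at h
  simpa using h

theorem tendstoInDistribution_sum_range_sub_div (hE : ∀ m, MemLp (E m) 2 P)
    (he : ∫ ω, E 0 ω ∂P = e) (hW : Var[E 0; P] = W) (hW0 : 0 < W) (hind : iIndepFun E P)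
    (hid : ∀ m, IdentDistrib (E m) (E 0) P P) :
    TendstoInDistribution
      (fun (M : ℕ) ω => (∑ m ∈ Finset.range M, E m ω - M * e) / Real.sqrt (M * W))
      atTop (id : ℝ → ℝ) (fun _ => P) (gaussianReal 0 1) := by
  have hu : Measurable fun y : ℝ => (y - e) / Real.sqrt W := by fun_prop
  -- The summands are standardised to mean `0` and variance `1`. At `M = 0` both sides are `0`,
  -- division by zero being zero.
  have hEq : ∀ (M : ℕ) ω, (∑ m ∈ Finset.range M, E m ω - M * e) / Real.sqrt (M * W) =
      (Real.sqrt M)⁻¹ * ∑ m ∈ Finset.range M, (E m ω - e) / Real.sqrt W := by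
    intro M ω
    rw [← Finset.sum_div, Finset.sum_sub_distrib, Real.sqrt_mul (Nat.cast_nonneg M)]
    simp only [Finset.sum_const, Finset.card_range, nsmul_eq_mul]
    rw [div_mul_eq_div_div_swap, div_eq_inv_mul _ (Real.sqrt M)]
  simp only [hEq]
  refine tendstoInDistribution_inv_sqrt_mul_sum HasLaw.id ?_ ?_
    (hind.comp (fun _ y => (y - e) / Real.sqrt W) fun _ => hu) fun m => (hid m).comp hu
  · rw [integral_div, integral_sub ((hE 0).integrable one_le_two) (integrable_const e), he]
    simp
  · simp only [Pi.pow_apply, div_pow, Real.sq_sqrt hW0.le]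
    rw [integral_div, ← he, ← variance_eq_integral (hE 0).aemeasurable, hW, div_self hW0.ne']

end IdenticallyDistributed

/-! ### Conditional laws under independence. -/

section Conditioning

variable {Ω : Type*} [MeasurableSpace Ω] {P : Measure Ω} [IsProbabilityMeasure P]

/-- If `X` and `Z` are independent, then `F (x, Z)` has the conditional law of `F (X, Z)` given
`X = x`. -/
theorem condDistrib_comp_of_indepFun {𝓧 𝓩 𝓨 : Type*} [MeasurableSpace 𝓧] [MeasurableSpace 𝓩]
    [MeasurableSpace 𝓨] [StandardBorelSpace 𝓨] [Nonempty 𝓨] {X : Ω → 𝓧} {Z : Ω → 𝓩}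
    (hX : Measurable X) (hZ : Measurable Z) (hXZ : IndepFun X Z P) {F : 𝓧 × 𝓩 → 𝓨}
    (hF : Measurable F) :
    ∀ᵐ x ∂(P.map X), condDistrib (fun ω => F (X ω, Z ω)) X P x = P.map fun ω => F (x, Z ω) := by
  have : IsProbabilityMeasure (P.map X) := Measure.isProbabilityMeasure_map hX.aemeasurable
  have : IsProbabilityMeasure (P.map Z) := Measure.isProbabilityMeasure_map hZ.aemeasurable
  -- The candidate kernel sends `x` to the law of `F (x, Z)`.
  let κ : Kernel 𝓧 𝓨 := (Kernel.id ×ₖ Kernel.const 𝓧 (P.map Z)).map F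
  have hκ : ∀ x, κ x = (P.map Z).map fun z => F (x, z) := by
    intro x
    rw [Kernel.map_apply _ hF, Kernel.prod_apply, Kernel.id_apply, Kernel.const_apply,
      Measure.dirac_prod, Measure.map_map hF (by fun_prop)]
    rfl
  have : IsMarkovKernel κ := Kernel.IsMarkovKernel.map _ hF
  have hmap : P.map (fun ω => (X ω, Z ω)) = (P.map X).prod (P.map Z) :=
    (indepFun_iff_map_prod_eq_prod_map_map hX.aemeasurable hZ.aemeasurable).1 hXZ
  -- By Tonelli for the product law of `(X, Z)`, the kernel disintegrates the joint law;
  -- almost-everywhere uniqueness of disintegrations then identifies it with `condDistrib`.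
  have hmain : P.map (fun ω => (X ω, F (X ω, Z ω))) = P.map X ⊗ₘ κ := by
    refine Measure.ext_of_lintegral _ fun f hf => ?_
    have hG : Measurable fun q : 𝓧 × 𝓩 => f (q.1, F q) := by fun_prop
    rw [Measure.lintegral_compProd hf, lintegral_map hf (by fun_prop)]
    have h1 : ∫⁻ ω, f (X ω, F (X ω, Z ω)) ∂P =
        ∫⁻ q, f (q.1, F q) ∂(P.map fun ω => (X ω, Z ω)) := by
      rw [lintegral_map hG (by fun_prop)]
    rw [h1, hmap, lintegral_prod _ hG.aemeasurable]
    refine lintegral_congr fun x => ?_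
    rw [hκ, lintegral_map (f := fun y => f (x, y)) (by fun_prop) (by fun_prop)]
  filter_upwards [condDistrib_ae_eq_of_measure_eq_compProd X
    (hF.comp (hX.prodMk hZ)).aemeasurable hmain] with x hx
  rw [Function.comp_def] at hx
  rw [hx, hκ, Measure.map_map (by fun_prop) hZ]
  rfl

end Conditioning

/-! ### Range and measurability of the powers and of the noise. -/

section Powers

variable {K : ℕ} {φ : Fin K → ℝ → ℝ} {g : ℝ → ℝ} {S : Set ℝ}

theorem mem_Icc_phiMin_phiMax (hφb : ∀ k, Bornology.IsBounded (φ k '' S)) (k : Fin K) {s : ℝ}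
    (hs : s ∈ S) : φ k s ∈ Set.Icc (phiMin φ S) (phiMax φ S) := by
  have hmem : φ k s ∈ φ k '' S := Set.mem_image_of_mem _ hs
  exact ⟨(ciInf_le (Set.finite_range _).bddBelow k).trans (csInf_le (hφb k).bddBelow hmem),
    (le_csSup (hφb k).bddAbove hmem).trans
      (le_ciSup (f := fun k => sSup (φ k '' S)) (Set.finite_range _).bddAbove k)⟩

/-- General measurable `q k` stand in for `g ∘ φ k`, whose regularity is known only on `𝒳`. -/
theorem measurable_overallNoise {q : Fin K → ℝ → ℝ} (hq : ∀ k, Measurable (q k)) (M : ℕ) :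
    Measurable fun z : (Fin K → ℝ) × ((Fin K × ℕ → ℝ) × (ℕ → ℂ)) =>
      overallNoise (fun k => q k (z.1 k)) M (fun k m => z.2.1 (k, m)) z.2.2 := by
  have hp : ∀ k, Measurable fun z : (Fin K → ℝ) × ((Fin K × ℕ → ℝ) × (ℕ → ℂ)) => q k (z.1 k) :=
    fun k => (hq k).comp (by fun_prop)
  have hS : ∀ k m, Measurable fun z : (Fin K → ℝ) × ((Fin K × ℕ → ℝ) × (ℕ → ℂ)) =>
      symbol (z.2.1 (k, m)) := fun k m => measurable_symbol.comp (by fun_prop)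
  have hS' : ∀ k m, Measurable fun z : (Fin K → ℝ) × ((Fin K × ℕ → ℝ) × (ℕ → ℂ)) =>
      star (symbol (z.2.1 (k, m))) := fun k m =>
    continuous_star.measurable.comp (hS k m)
  unfold overallNoise noise1 noise2 noise3
  fun_prop

end Powers

/-! ### The channel output as a sum of independent circular summands. -/

section Signals

variable {Ω : Type*} {K : ℕ}

/-- The summands of the channel output at position `m`: the noise sample and the `K` transmitted
symbols. -/
noncomputable def summand (p : Fin K → ℝ) (Θ : Fin K → ℕ → Ω → ℝ) (N : ℕ → Ω → ℂ) :
    ℕ × Option (Fin K) → Ω → ℂ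
  | (m, none) => N m
  | (m, some k) => fun ω => (Real.sqrt (p k) : ℂ) * symbol (Θ k m ω)

variable {p : Fin K → ℝ} {Θ : Fin K → ℕ → Ω → ℝ} {N : ℕ → Ω → ℂ}

theorem received_eq_sum_summand (m : ℕ) (ω : Ω) :
    received p (fun k m => Θ k m ω) (fun m => N m ω) m = ∑ o, summand p Θ N (m, o) ω := by
  rw [Fintype.sum_option, received, add_comm]
  rfl

variable [MeasurableSpace Ω] {P : Measure Ω}

theorem measurable_summand (hΘ : ∀ k m, Measurable (Θ k m)) (hN : ∀ m, Measurable (N m)) :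
    ∀ q, Measurable (summand p Θ N q)
  | (m, none) => hN m
  | (m, some k) => (measurable_symbol.comp (hΘ k m)).const_mul _

theorem iIndepFun_summand (hΘi : iIndepFun (fun q : Fin K × ℕ => Θ q.1 q.2) P)
    (hNi : iIndepFun N P)
    (hΘN : IndepFun (fun ω (q : Fin K × ℕ) => Θ q.1 q.2 ω) (fun ω m => N m ω) P) :
    iIndepFun (summand p Θ N) P := by
  have hS := measurable_symbol
  have hψ : Measurable fun (x : Fin K × ℕ → ℝ) (q : Fin K × ℕ) =>
      (Real.sqrt (p q.1) : ℂ) * symbol (x q) :=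
    measurable_pi_lambda _ fun q => (hS.comp (measurable_pi_apply q)).const_mul _
  have h := iIndepFun_sumElim
    (hΘi.comp (fun q x => (Real.sqrt (p q.1) : ℂ) * symbol x) fun q => hS.const_mul _) hNi
    (hΘN.comp hψ measurable_id)
  -- Reindexes phases and noise by sequence position, so that each row is what one channel output
  -- uses.
  let ι : ℕ × Option (Fin K) → (Fin K × ℕ) ⊕ ℕ := fun q =>
    q.2.elim (Sum.inr q.1) fun k => Sum.inl (k, q.1)
  have hι : Function.Injective ι := by
    rintro ⟨m, _ | k⟩ ⟨m', _ | k'⟩ hq <;> simp_all [ι]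
  convert! h.precomp hι using 1
  funext q
  obtain ⟨m, _ | k⟩ := q <;> rfl

theorem map_summand_eq (hΘ : ∀ k m, Measurable (Θ k m))
    (hΘu : ∀ k m, pdf.IsUniform (Θ k m) (Set.Ico 0 (2 * Real.pi)) P) {v : ℝ≥0}
    (hNg : ∀ m, HasLaw (N m) (complexGaussian v) P) (m m' : ℕ) :
    ∀ o, P.map (summand p Θ N (m, o)) = P.map (summand p Θ N (m', o))
  | none => (hNg m).map_eq.trans (hNg m').map_eq.symm
  | some k => by
    have hm : Measurable fun x : ℝ => (Real.sqrt (p k) : ℂ) * symbol x :=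
      measurable_symbol.const_mul _
    have h : ∀ j, P.map (summand p Θ N (j, some k)) = (P.map (Θ k j)).map
        fun x : ℝ => (Real.sqrt (p k) : ℂ) * symbol x := fun j => by
      rw [Measure.map_map hm (hΘ k j)]
      rfl
    rw [h, h, show P.map (Θ k m) = _ from hΘu k m, show P.map (Θ k m') = _ from hΘu k m']

theorem hasCircularMoments_summand [IsProbabilityMeasure P]
    (hp : ∀ k, 0 ≤ p k) (hΘ : ∀ k m, Measurable (Θ k m))
    (hΘu : ∀ k m, pdf.IsUniform (Θ k m) (Set.Ico 0 (2 * Real.pi)) P) {v : ℝ≥0}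
    (hNg : ∀ m, HasLaw (N m) (complexGaussian v) P) (m : ℕ) :
    ∀ o, HasCircularMoments P (summand p Θ N (m, o)) (o.elim (v : ℝ) p)
      (o.elim ((v : ℝ) ^ 2) fun _ => 0)
  | none => by
    have h := hasCircularMoments_complexGaussian v
    have hN := (hNg m).aemeasurable
    rw [← (hNg m).map_eq] at h
    have e := fun i j => mixedMoment_map hN measurable_id i j
    exact ⟨h.memLp.comp_of_map hN, (e _ _).symm.trans h.one_zero, (e _ _).symm.trans h.two_zero,
      (e _ _).symm.trans h.two_one, (e _ _).symm.trans h.one_one, (e _ _).symm.trans h.two_two⟩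
  | some k => hasCircularMoments_symbol (hΘ k m) (hΘu k m) (hp k)

theorem iIndepFun_norm_received_sq [IsProbabilityMeasure P]
    (hΘ : ∀ k m, Measurable (Θ k m)) (hN : ∀ m, Measurable (N m))
    (hΘi : iIndepFun (fun q : Fin K × ℕ => Θ q.1 q.2) P) (hNi : iIndepFun N P)
    (hΘN : IndepFun (fun ω (q : Fin K × ℕ) => Θ q.1 q.2 ω) (fun ω m => N m ω) P) :
    iIndepFun (fun m ω => ‖received p (fun k m => Θ k m ω) (fun m => N m ω) m‖ ^ 2) P := by
  simp only [received_eq_sum_summand]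
  exact (iIndepFun_rows (measurable_summand hΘ hN) (iIndepFun_summand (p := p) hΘi hNi hΘN)).comp
    (fun _ y => ‖∑ o, y o‖ ^ 2) fun _ => by fun_prop

/-- By independence each row of summands has a product law, and its factors do not depend on the
position. -/
theorem identDistrib_norm_received_sq (hΘ : ∀ k m, Measurable (Θ k m))
    (hΘu : ∀ k m, pdf.IsUniform (Θ k m) (Set.Ico 0 (2 * Real.pi)) P) (hN : ∀ m, Measurable (N m))
    {v : ℝ≥0} (hNg : ∀ m, HasLaw (N m) (complexGaussian v) P)
    (hΘi : iIndepFun (fun q : Fin K × ℕ => Θ q.1 q.2) P) (hNi : iIndepFun N P)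
    (hΘN : IndepFun (fun ω (q : Fin K × ℕ) => Θ q.1 q.2 ω) (fun ω m => N m ω) P) (m m' : ℕ) :
    IdentDistrib (fun ω => ‖received p (fun k m => Θ k m ω) (fun m => N m ω) m‖ ^ 2)
      (fun ω => ‖received p (fun k m => Θ k m ω) (fun m => N m ω) m'‖ ^ 2) P P := by
  simp only [received_eq_sum_summand]
  have hrow : ∀ i, P.map (fun ω o => summand p Θ N (i, o) ω) =
      Measure.pi fun o => P.map (summand p Θ N (i, o)) := fun i =>
    ((iIndepFun_summand hΘi hNi hΘN).precomp (g := fun o => (i, o))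
      fun a b h => (Prod.mk.inj h).2).map_fun_eq_pi_map
      fun o => (measurable_summand hΘ hN (i, o)).aemeasurable
  have hm : ∀ i, AEMeasurable (fun ω o => summand p Θ N (i, o) ω) P := fun i =>
    (measurable_pi_lambda _ fun o => measurable_summand hΘ hN (i, o)).aemeasurable
  have h : IdentDistrib (fun ω o => summand p Θ N (m, o) ω)
      (fun ω o => summand p Θ N (m', o) ω) P P :=
    ⟨hm m, hm m', by rw [hrow, hrow]; simp only [map_summand_eq hΘ hΘu hNg m m']⟩
  exact h.comp (u := fun y : Option (Fin K) → ℂ => ‖∑ o, y o‖ ^ 2) (by fun_prop)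

/-- The last parameter combines the cross terms among symbols, those between symbols and noise, and
the intrinsic `v²` of the noise. -/
theorem hasCircularMoments_received [IsProbabilityMeasure P]
    (hp : ∀ k, 0 ≤ p k) (hΘ : ∀ k m, Measurable (Θ k m))
    (hΘu : ∀ k m, pdf.IsUniform (Θ k m) (Set.Ico 0 (2 * Real.pi)) P) (hN : ∀ m, Measurable (N m))
    {v : ℝ≥0} (hNg : ∀ m, HasLaw (N m) (complexGaussian v) P)
    (hΘi : iIndepFun (fun q : Fin K × ℕ => Θ q.1 q.2) P) (hNi : iIndepFun N P)
    (hΘN : IndepFun (fun ω (q : Fin K × ℕ) => Θ q.1 q.2 ω) (fun ω m => N m ω) P) (m : ℕ) :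
    HasCircularMoments P (fun ω => received p (fun k m => Θ k m ω) (fun m => N m ω) m)
      (v + ∑ k, p k)
      (((∑ k, p k) ^ 2 - ∑ k, p k ^ 2) + 2 * v * ∑ k, p k + (v : ℝ) ^ 2) := by
  simp only [received_eq_sum_summand]
  have h := HasCircularMoments.sum (hasCircularMoments_summand hp hΘ hΘu hNg m)
    (fun o => measurable_summand hΘ hN (m, o))
    ((iIndepFun_summand hΘi hNi hΘN).precomp (g := fun o => (m, o))
      fun a b h => (Prod.mk.inj h).2) Finset.univ
  convert! h using 1
  · simp [Fintype.sum_option]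
  · simp only [Fintype.sum_option, Option.elim_none, Option.elim_some, Finset.sum_const_zero]
    ring

end Signals

theorem two_mul_sum_Ioi_mul {K : ℕ} (p : Fin K → ℝ) :
    2 * ∑ k, ∑ l ∈ Finset.Ioi k, p k * p l = (∑ k, p k) ^ 2 - ∑ k, p k ^ 2 := by
  have h1 : ∀ k, ∑ l, p k * p l =
      ∑ l ∈ Finset.Ioi k, p k * p l + (∑ l ∈ Finset.Iio k, p k * p l + p k ^ 2) := by
    intro k
    have hd : Disjoint (Finset.Ioi k) (Finset.Iic k) := by
      rw [Finset.disjoint_left]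
      simp
    rw [← Finset.Iio_insert k] at hd
    rw [← Finset.sum_subset (Finset.subset_univ (Finset.Ioi k ∪ insert k (Finset.Iio k))),
      Finset.sum_union hd, Finset.sum_insert (by simp)]
    · ring
    · intro l _ hl
      simp only [Finset.mem_union, Finset.mem_insert, Finset.mem_Ioi, Finset.mem_Iio] at hl
      omega
  have h2 : ∑ k, ∑ l ∈ Finset.Iio k, p k * p l = ∑ k, ∑ l ∈ Finset.Ioi k, p k * p l := by
    rw [Finset.sum_comm' (t' := Finset.univ) (s' := fun l => Finset.Ioi l) (by simp)]
    simp only [mul_comm]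
  rw [sq, Finset.sum_mul_sum]
  simp only [h1, Finset.sum_add_distrib, h2]
  ring

end CoMAC

/-! ### Conditional law, moments and normal limit of the overall noise. -/

theorem proposition2
    {Ω : Type*} [MeasurableSpace Ω] (P : Measure Ω) [IsProbabilityMeasure P]
    (K : ℕ) (hK : 1 ≤ K)
    (Pmax : ℝ) (hPmax : 0 < Pmax) (noiseVar : ℝ≥0) (hnoiseVar : 0 < noiseVar)
    -- sensing range `[smin, smax]` and compact state space `𝒳` of the sensor readings
    (smin smax : ℝ) (hs : smin < smax)
    (𝒳 : Set ℝ) (h𝒳 : IsCompact 𝒳) (h𝒳s : 𝒳 ⊆ Set.Icc smin smax)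
    -- pre-processing functions and the map onto the feasible transmit powers
    (φ : Fin K → ℝ → ℝ) (hφ : ∀ k, ContinuousOn (φ k) 𝒳)
    (hφb : ∀ k, Bornology.IsBounded (φ k '' Set.Icc smin smax))
    (g : ℝ → ℝ)
    (hgc : ContinuousOn g (Set.Icc (CoMAC.phiMin φ (Set.Icc smin smax))
      (CoMAC.phiMax φ (Set.Icc smin smax))))
    (hgb : Set.BijOn g (Set.Icc (CoMAC.phiMin φ (Set.Icc smin smax))
      (CoMAC.phiMax φ (Set.Icc smin smax))) (Set.Icc 0 Pmax))
    -- sensor readings, phases, receiver noise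
    (X : Ω → Fin K → ℝ) (hX : Measurable X) (hX𝒳 : ∀ ω k, X ω k ∈ 𝒳)
    (Θ : Fin K → ℕ → Ω → ℝ) (hΘ : ∀ k m, Measurable (Θ k m))
    (hΘu : ∀ k m, pdf.IsUniform (Θ k m) (Set.Ico 0 (2 * Real.pi)) P)
    (N : ℕ → Ω → ℂ) (hN : ∀ m, Measurable (N m))
    (hNg : ∀ m, HasLaw (N m) (CoMAC.complexGaussian noiseVar) P)
    -- independence of all phases, of all noise samples, and of the three families
    (hΘi : iIndepFun (fun q : Fin K × ℕ => Θ q.1 q.2) P)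
    (hNi : iIndepFun N P)
    (hΘN : IndepFun (fun ω (q : Fin K × ℕ) => Θ q.1 q.2 ω) (fun ω m => N m ω) P)
    (hXΘN : IndepFun X
      (fun ω => ((fun q : Fin K × ℕ => Θ q.1 q.2 ω), (fun m => N m ω))) P) :
    -- `Δ|x` has the conditional law of the overall noise given `X = x`
    (∀ M : ℕ, ∀ᵐ x ∂(P.map X),
      condDistrib (fun ω => CoMAC.noiseGiven φ g Θ N M (X ω) ω) X P x
        = P.map (CoMAC.noiseGiven φ g Θ N M x)) ∧
    ∀ x : Fin K → ℝ, (∀ k, x k ∈ 𝒳) →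
      (∀ M : ℕ,
        MemLp (CoMAC.noiseGiven φ g Θ N M x) 2 P ∧
        ∫ ω, CoMAC.noiseGiven φ g Θ N M x ω ∂P = M * noiseVar ∧
        CoMAC.noiseVarGiven P φ g Θ N noiseVar M x =
          2 * M * ∑ k, ∑ l ∈ Finset.Ioi k, CoMAC.power φ g x k * CoMAC.power φ g x l
            + 2 * M * noiseVar * ∑ k, CoMAC.power φ g x k + M * (noiseVar : ℝ) ^ 2) ∧
      TendstoInDistribution
        (fun (M : ℕ) ω => (CoMAC.noiseGiven φ g Θ N M x ω - M * noiseVar) /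
          Real.sqrt (CoMAC.noiseVarGiven P φ g Θ N noiseVar M x))
        atTop (id : ℝ → ℝ) (fun _ => P) (gaussianReal 0 1) := by
  classical
  have hq : ∀ k, ∀ s ∈ 𝒳, φ k s ∈ Set.Icc (CoMAC.phiMin φ (Set.Icc smin smax))
      (CoMAC.phiMax φ (Set.Icc smin smax)) := fun k s hs =>
    CoMAC.mem_Icc_phiMin_phiMax hφb k (h𝒳s hs)
  refine ⟨fun M => ?_, fun x hx => ?_⟩
  -- Extension by zero off the compact set `𝒳` gives globally measurable powers; the readings never
  -- leave `𝒳`, so nothing changes there.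
  · let q : Fin K → ℝ → ℝ := fun k => 𝒳.piecewise (g ∘ φ k) 0
    have hqm : ∀ k, Measurable (q k) := fun k =>
      (hgc.comp (hφ k) (hq k)).measurable_piecewise continuousOn_const h𝒳.measurableSet
    have hpow : ∀ x : Fin K → ℝ, (∀ k, x k ∈ 𝒳) → CoMAC.power φ g x = fun k => q k (x k) := by
      intro x hx
      funext k
      simp only [q, Set.piecewise_eq_of_mem _ _ _ (hx k), CoMAC.power, Function.comp_apply]
    let F : (Fin K → ℝ) × ((Fin K × ℕ → ℝ) × (ℕ → ℂ)) → ℝ := fun z =>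
      CoMAC.overallNoise (fun k => q k (z.1 k)) M (fun k m => z.2.1 (k, m)) z.2.2
    have hF : Measurable F := CoMAC.measurable_overallNoise hqm M
    have hZ : Measurable fun ω => ((fun q : Fin K × ℕ => Θ q.1 q.2 ω), (fun m => N m ω)) :=
      (measurable_pi_lambda _ fun q : Fin K × ℕ => hΘ q.1 q.2).prodMk (measurable_pi_lambda _ hN)
    have hmem : ∀ᵐ x ∂(P.map X), ∀ k, x k ∈ 𝒳 := by
      have hms : MeasurableSet {x : Fin K → ℝ | ∀ k, x k ∈ 𝒳} := by
        simp only [Set.ofPred_forall]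
        exact MeasurableSet.iInter fun k => measurable_pi_apply k h𝒳.measurableSet
      exact (ae_map_iff hX.aemeasurable hms).2 (ae_of_all _ hX𝒳)
    filter_upwards [CoMAC.condDistrib_comp_of_indepFun hX hZ hXΘN hF, hmem] with x hx hx𝒳
    have e1 : (fun ω => CoMAC.noiseGiven φ g Θ N M (X ω) ω) = fun ω =>
        F (X ω, ((fun q : Fin K × ℕ => Θ q.1 q.2 ω), (fun m => N m ω))) := by
      funext ω
      simp only [CoMAC.noiseGiven, F, hpow _ (hX𝒳 ω)]
    have e2 : CoMAC.noiseGiven φ g Θ N M x = fun ω =>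
        F (x, ((fun q : Fin K × ℕ => Θ q.1 q.2 ω), (fun m => N m ω))) := by
      funext ω
      simp only [CoMAC.noiseGiven, F, hpow _ hx𝒳]
    rw [e1, e2, hx]
  · set p := CoMAC.power φ g x with hpdef
    have hp : ∀ k, 0 ≤ p k := fun k => (hgb.mapsTo (hq k _ (hx k))).1
    set E : ℕ → Ω → ℝ := fun m ω =>
      ‖CoMAC.received p (fun k m => Θ k m ω) (fun m => N m ω) m‖ ^ 2 with hEdef
    have hcirc := CoMAC.hasCircularMoments_received hp hΘ hΘu hN hNg hΘi hNi hΘN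
    have hE : ∀ m, MemLp (E m) 2 P := fun m => (hcirc m).memLp_norm_sq
    have hmean : ∀ m, ∫ ω, E m ω ∂P = noiseVar + ∑ k, p k := fun m =>
      (hcirc m).integral_norm_sq
    have hvar := fun m => (hcirc m).variance_norm_sq
    rw [← CoMAC.two_mul_sum_Ioi_mul p] at hvar
    set W : ℝ := 2 * ∑ k, ∑ l ∈ Finset.Ioi k, p k * p l + 2 * noiseVar * ∑ k, p k +
      (noiseVar : ℝ) ^ 2 with hWdef
    -- Strict positivity comes from the noise term alone: all the powers may vanish.
    have hW0 : 0 < W := by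
      have h1 : 0 ≤ ∑ k, ∑ l ∈ Finset.Ioi k, p k * p l :=
        Finset.sum_nonneg fun k _ => Finset.sum_nonneg fun l _ => mul_nonneg (hp k) (hp l)
      have h2 : 0 ≤ ∑ k, p k := Finset.sum_nonneg fun k _ => hp k
      have h3 : (0 : ℝ) < noiseVar := hnoiseVar
      positivity
    have hindE : iIndepFun E P := CoMAC.iIndepFun_norm_received_sq hΘ hN hΘi hNi hΘN
    have hnoise : ∀ M : ℕ, CoMAC.noiseGiven φ g Θ N M x = fun ω =>
        ∑ m ∈ Finset.range M, E m ω - M * ∑ k, p k := by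
      intro M
      funext ω
      simp only [hEdef, CoMAC.energy_eq p hp, CoMAC.noiseGiven, ← hpdef, add_sub_cancel_left]
    -- Centring `Δ|x` at `M σ_N²` is centring the energy sum at its own mean.
    have hcentre : ∀ (M : ℕ) ω, CoMAC.noiseGiven φ g Θ N M x ω - M * noiseVar =
        ∑ m ∈ Finset.range M, E m ω - M * (noiseVar + ∑ k, p k) := by
      intro M ω
      rw [hnoise]
      ring
    have hV : ∀ M : ℕ, CoMAC.noiseVarGiven P φ g Θ N noiseVar M x = M * W := by
      intro M
      simp only [CoMAC.noiseVarGiven, hcentre]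
      exact CoMAC.integral_sum_range_sub_sq hE hmean hvar hindE M
    refine ⟨fun M => ⟨?_, ?_, ?_⟩, ?_⟩
    · rw [hnoise]
      exact CoMAC.memLp_sum_sub hE M _
    · rw [hnoise, integral_sub
        (integrable_finsetSum _ fun m _ => (hE m).integrable one_le_two) (integrable_const _),
        CoMAC.integral_sum_range hE hmean]
      simp
      ring
    · rw [hV, hWdef]
      ring
    · simp only [hV, hcentre]
      exact CoMAC.tendstoInDistribution_sum_range_sub_div hE (hmean 0) (hvar 0) hW0 hindE
        fun m => CoMAC.identDistrib_norm_received_sq hΘ hΘu hN hNg hΘi hNi hΘN m 0
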